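/- Let $Y_1,Y_2,\dots$ be independent copies of a real random variable $Y$ whose distribution function $G$ is continuous, and let $l_G=\inf\{x: G(x)>0\}\ge-\infty$ and $r_G=\sup\{x: G(x)<1\}\le\infty$. Define the upper record times by $L(1)=1$ and $L(n)=\min\{j>L(n-1): Y_j>Y_{L(n-1)}\}$ for $n>1$ (these are almost surely finite), and the upper record values by $Y(n)=Y_{L(n)}$. Let $g$ be a real function that is continuous and strictly increasing on $(l_G,r_G)$, with $\tau:=\lim_{y\to l_G+}g(y)>-\infty$ and $\lim_{y\to r_G-}g(y)=\infty$. Let $n,k$ be integers with $1\le k\le n-1$. Then $$E[g(Y(n))\mid Y(n-k)=s,\ Y(n+1)=t]=\frac{k\,g(t)+g(s)}{k+1}\qquad(l_G<s<t<r_G)$$ holds if and only if, for some constant $c>0$, $$G(y)=1-e^{-c[g(y)-\tau]}\qquad(l_G<y<r_G).$$ Here the left-hand side of the first equation is the integral of $g$ with respect to the regular conditional distribution of $Y(n)$ given $(Y(n-k),Y(n+1))=(s,t)$, and the equation is understood for almost every $(s,t)$ with respect to the joint law of $(Y(n-k),Y(n+1))$. -/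

import Mathlib

open MeasureTheory ProbabilityTheory Filter Topology

/-- Upper record times `L(1) = 1`, `L(n) = min {j : j > L(n-1), y_j > y_{L(n-1)}}` for `n > 1`, of a
real sequence `y₁, y₂, …`. The index `0` is not used: `L(0)` and `y₀` are placeholders.
If there is no further record then the minimum over the empty set gets the value `0`. -/
noncomputable def recordTime (y : ℕ → ℝ) : ℕ → ℕ
  | 0 => 0
  | 1 => 1
  | n + 2 => sInf {j : ℕ | recordTime y (n + 1) < j ∧ y (recordTime y (n + 1)) < y j}

/-- The `n`-th upper record value `Y(n) = Y_{L(n)}` of the random sequence `Y₁, Y₂, …`. -/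
noncomputable def recordValue {Ω : Type*} (Y : ℕ → Ω → ℝ) (n : ℕ) (ω : Ω) : ℝ :=
  Y (recordTime (fun i => Y i ω) n) ω

/-- The left extremity `l_G = inf {x : G(x) > 0}`, in `[-∞, ∞]`, where `G` is the distribution
function of the law `ν`. -/
noncomputable def leftExtremity (ν : Measure ℝ) : EReal :=
  sInf ((fun x : ℝ => (x : EReal)) '' {x : ℝ | 0 < cdf ν x})

/-- The right extremity `r_G = sup {x : G(x) < 1}`, in `[-∞, ∞]`, where `G` is the distribution
function of the law `ν`. -/
noncomputable def rightExtremity (ν : Measure ℝ) : EReal :=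
  sSup ((fun x : ℝ => (x : EReal)) '' {x : ℝ | cdf ν x < 1})

/-- The open interval `(l_G, r_G)`, as a set of real numbers. -/
def openSupport (ν : Measure ℝ) : Set ℝ :=
  {y : ℝ | leftExtremity ν < (y : EReal) ∧ (y : EReal) < rightExtremity ν}

/-- The filter of real `y → l_G+` (which is `y → -∞` when `l_G = -∞`). -/
noncomputable def toLeftExtremity (ν : Measure ℝ) : Filter ℝ :=
  Filter.comap (fun x : ℝ => (x : EReal)) (𝓝[>] (leftExtremity ν))

/-- The filter of real `y → r_G-` (which is `y → ∞` when `r_G = ∞`). -/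
noncomputable def toRightExtremity (ν : Measure ℝ) : Filter ℝ :=
  Filter.comap (fun x : ℝ => (x : EReal)) (𝓝[<] (rightExtremity ν))

/-- `E[g(Z) | U = s, V = t] = m(s, t)` for `l_G < s < t < r_G`. The left side is the integral of `g`
against the regular conditional distribution of `Z` given `(U, V) = (s, t)`. That distribution is
determined up to null sets of the law of `(U, V)`, so the equation is for almost all `(s, t)`
under this law. The integral is required to exist; `g(Z)` need not be integrable itself. -/
def RegressionEq {Ω : Type*} [MeasurableSpace Ω] (P : Measure Ω) [IsFiniteMeasure P]
    (ν : Measure ℝ) (g : ℝ → ℝ) (Z U V : Ω → ℝ) (m : ℝ → ℝ → ℝ) : Prop :=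
  ∀ᵐ p : ℝ × ℝ ∂(P.map (fun ω => (U ω, V ω))),
    p.1 ∈ openSupport ν → p.2 ∈ openSupport ν → p.1 < p.2 →
      Integrable g (condDistrib Z (fun ω => (U ω, V ω)) P p) ∧
        ∫ x, g x ∂(condDistrib Z (fun ω => (U ω, V ω)) P p) = m p.1 p.2

/-! Put `H = -log (1 - G)`, with generalized inverse `q` on `(0, ∞)`. Since `G` is continuous, `q`
carries the standard exponential law to `ν`. By memorylessness the record sequence then has the law
of `q(Γ₁), q(Γ₂), …`, where the `Γ_j` are partial sums of independent standard exponentials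
(`lintegral_recordState`, `lintegral_iterate_nextRecord`). Given `Γ_{n-k} = u` and `Γ_{n+1} = z`,
the `k` points between are distributed as ordered uniforms on `(u, z)`, so the last one is `u + (z -
u)B` with `B` of density `k b^(k-1)`. This is `map_recordState_triple_eq_compProd`.

With `h = g ∘ q` the regression equation says that `∫₀¹ k b^(k-1) h(u + (z-u)b) db = (k h(z) +
h(u))/(k+1)` for almost all `0 < u < z`. Affine `h` satisfy it because `E B = k/(k+1)`; the stated
form of `G` means `g = τ + H/c`, so that `h` is affine.

Conversely, fix a good `u`. The equation expresses `h(z)` through an integral of `h`; as `h` is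
monotone, this upgrades "almost every `z`" to "every `z > u`" and makes `h` continuous there. The
integral then solves a linear differential equation, which forces `h` to be affine beyond `u`
(`eq_affine_of_integral_eq`). Good `u` exist arbitrarily near `0`, so `h(z) = az + b` on `(0, ∞)`.
The limit at `l_G` gives `b = τ`, and monotonicity of `g` turns this into `g = τ + aH` on the whole
support (`exists_cdf_eq_of_affine`), with `c = 1/a`. -/

/-- The cumulative hazard function `-log (1 - G)` of the law `ν`. -/
noncomputable def cumHazard (ν : Measure ℝ) (y : ℝ) : ℝ := -Real.log (1 - cdf ν y)

/-- The generalized inverse of the cumulative hazard function on `(0, ∞)`. -/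
noncomputable def hazardQuantile (ν : Measure ℝ) (u : ℝ) : ℝ :=
  if 0 < u then sInf {y : ℝ | 1 - Real.exp (-u) ≤ cdf ν y} else 0

/-! ### The hazard scale and its quantile function. -/

section Quantile

variable {ν : Measure ℝ}

lemma measurable_cumHazard : Measurable (cumHazard ν) :=
  (Real.measurable_log.comp (measurable_const.sub (cdf ν).mono.measurable)).neg

lemma one_sub_exp_neg_mem_Ioo {u : ℝ} (hu : 0 < u) : 1 - Real.exp (-u) ∈ Set.Ioo (0 : ℝ) 1 := by
  have h1 : Real.exp (-u) < 1 := by simpa using hu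
  have h2 := Real.exp_pos (-u)
  constructor <;> linarith

/-- Continuity of `G` makes the superlevel set closed; the limits of `G` at `±∞` make it nonempty
and bounded below. -/
lemma isLeast_hazardQuantile (hG : Continuous (cdf ν)) {u : ℝ} (hu : 0 < u) :
    IsLeast {y : ℝ | 1 - Real.exp (-u) ≤ cdf ν y} (hazardQuantile ν u) := by
  obtain ⟨h0, h1⟩ := one_sub_exp_neg_mem_Ioo hu
  have hne : {y : ℝ | 1 - Real.exp (-u) ≤ cdf ν y}.Nonempty :=
    ((tendsto_cdf_atTop ν).eventually_const_le h1).exists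
  have hbdd : BddBelow {y : ℝ | 1 - Real.exp (-u) ≤ cdf ν y} := by
    obtain ⟨a, ha⟩ := ((tendsto_cdf_atBot ν).eventually_lt_const h0).exists
    refine ⟨a, fun y hy => ?_⟩
    by_contra hlt
    have := (cdf ν).mono (not_le.mp hlt).le
    have hy' : 1 - Real.exp (-u) ≤ cdf ν y := hy
    linarith
  rw [hazardQuantile, if_pos hu]
  exact (isClosed_le continuous_const hG).isLeast_csInf hne hbdd

lemma hazardQuantile_le_iff (hG : Continuous (cdf ν)) {u : ℝ} (hu : 0 < u) (y : ℝ) :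
    hazardQuantile ν u ≤ y ↔ 1 - Real.exp (-u) ≤ cdf ν y :=
  ⟨fun h => (isLeast_hazardQuantile hG hu).1.trans ((cdf ν).mono h),
    fun h => (isLeast_hazardQuantile hG hu).2 h⟩

lemma cdf_hazardQuantile (hG : Continuous (cdf ν)) {u : ℝ} (hu : 0 < u) :
    cdf ν (hazardQuantile ν u) = 1 - Real.exp (-u) := by
  refine le_antisymm ?_ (isLeast_hazardQuantile hG hu).1
  by_contra! hlt
  obtain ⟨y, hy, hyq⟩ := (((hG.tendsto (hazardQuantile ν u)).eventually_const_lt hlt).filter_mono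
    nhdsWithin_le_nhds |>.and (self_mem_nhdsWithin (s := Set.Iio (hazardQuantile ν u)))).exists
  exact not_lt.mpr ((hazardQuantile_le_iff hG hu y).mpr hy.le) hyq

lemma cumHazard_hazardQuantile (hG : Continuous (cdf ν)) {u : ℝ} (hu : 0 < u) :
    cumHazard ν (hazardQuantile ν u) = u := by
  simp [cumHazard, cdf_hazardQuantile hG hu]

lemma hazardQuantile_lt_iff (hG : Continuous (cdf ν)) {u v : ℝ} (hu : 0 < u) (hv : 0 < v) :
    hazardQuantile ν u < hazardQuantile ν v ↔ u < v := by
  rw [← not_le, hazardQuantile_le_iff hG hv, cdf_hazardQuantile hG hu, not_le]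
  simp

lemma strictMonoOn_hazardQuantile (hG : Continuous (cdf ν)) :
    StrictMonoOn (hazardQuantile ν) (Set.Ioi 0) :=
  fun _ hu _ hv huv => (hazardQuantile_lt_iff hG hu hv).mpr huv

lemma measurable_hazardQuantile (hG : Continuous (cdf ν)) : Measurable (hazardQuantile ν) := by
  refine measurable_of_Iic fun y => ?_
  -- For `u ≤ 0` the quantile has the default value `0`, hence the second piece.
  have : hazardQuantile ν ⁻¹' Set.Iic y =
      (Set.Ioi 0 ∩ {u | 1 - Real.exp (-u) ≤ cdf ν y}) ∪ (Set.Iic 0 ∩ {_u | 0 ≤ y}) := by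
    ext u
    by_cases hu : 0 < u
    · simp [hazardQuantile_le_iff hG hu, hu, hu.not_ge]
    · simp [hu, hazardQuantile, not_lt.mp hu]
  rw [this]
  exact (measurableSet_Ioi.inter (measurableSet_le (by fun_prop) measurable_const)).union
    (measurableSet_Iic.inter (MeasurableSet.const _))

/-- By continuity the strict inequalities for `G` persist slightly to the left and right of `y`, so
that `y` stays strictly inside the extremities. -/
lemma mem_openSupport_iff (hG : Continuous (cdf ν)) (y : ℝ) :
    y ∈ openSupport ν ↔ 0 < cdf ν y ∧ cdf ν y < 1 := by
  constructor
  · rintro ⟨h1, h2⟩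
    rw [leftExtremity, sInf_lt_iff] at h1
    rw [rightExtremity, lt_sSup_iff] at h2
    obtain ⟨_, ⟨x, hx, rfl⟩, hxy⟩ := h1
    obtain ⟨_, ⟨z, hz, rfl⟩, hyz⟩ := h2
    exact ⟨lt_of_lt_of_le hx ((cdf ν).mono (EReal.coe_lt_coe_iff.mp hxy).le),
      lt_of_le_of_lt ((cdf ν).mono (EReal.coe_lt_coe_iff.mp hyz).le) hz⟩
  · rintro ⟨h1, h2⟩
    obtain ⟨x, hx, hxy⟩ := (((hG.tendsto y).eventually_const_lt h1).filter_mono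
      nhdsWithin_le_nhds |>.and (self_mem_nhdsWithin (s := Set.Iio y))).exists
    obtain ⟨z, hz, hyz⟩ := (((hG.tendsto y).eventually_lt_const h2).filter_mono
      nhdsWithin_le_nhds |>.and (self_mem_nhdsWithin (s := Set.Ioi y))).exists
    exact ⟨lt_of_le_of_lt (sInf_le ⟨x, hx, rfl⟩) (EReal.coe_lt_coe_iff.mpr hxy),
      lt_of_lt_of_le (EReal.coe_lt_coe_iff.mpr hyz) (le_sSup ⟨z, hz, rfl⟩)⟩

lemma isOpen_openSupport (hG : Continuous (cdf ν)) : IsOpen (openSupport ν) := by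
  have : openSupport ν = {y | 0 < cdf ν y} ∩ {y | cdf ν y < 1} :=
    Set.ext (mem_openSupport_iff hG)
  rw [this]
  exact (isOpen_lt continuous_const hG).inter (isOpen_lt hG continuous_const)

lemma hazardQuantile_mem_openSupport (hG : Continuous (cdf ν)) {u : ℝ} (hu : 0 < u) :
    hazardQuantile ν u ∈ openSupport ν := by
  rw [mem_openSupport_iff hG, cdf_hazardQuantile hG hu]
  exact one_sub_exp_neg_mem_Ioo hu

lemma cumHazard_pos {y : ℝ} (h0 : 0 < cdf ν y) (h1 : cdf ν y < 1) : 0 < cumHazard ν y :=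
  neg_pos.mpr (Real.log_neg (by linarith) (by linarith))

lemma exp_neg_cumHazard {y : ℝ} (h1 : cdf ν y < 1) :
    Real.exp (-cumHazard ν y) = 1 - cdf ν y := by
  rw [cumHazard, neg_neg, Real.exp_log (by linarith)]

lemma tendsto_hazardQuantile_toLeftExtremity (hG : Continuous (cdf ν)) :
    Tendsto (hazardQuantile ν) (𝓝[>] 0) (toLeftExtremity ν) := by
  rw [toLeftExtremity, tendsto_comap_iff]
  refine tendsto_nhdsWithin_iff.mpr ⟨tendsto_order.mpr ⟨fun a ha => ?_, fun a ha => ?_⟩, ?_⟩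
  · filter_upwards [self_mem_nhdsWithin] with u hu
    exact ha.trans (hazardQuantile_mem_openSupport hG hu).1
  · rw [leftExtremity, gt_iff_lt, sInf_lt_iff] at ha
    obtain ⟨_, ⟨y, hy, rfl⟩, hya⟩ := ha
    have hcont : Tendsto (fun u : ℝ => 1 - Real.exp (-u)) (𝓝[>] 0) (𝓝 0) := by
      have : Continuous fun u : ℝ => 1 - Real.exp (-u) := by fun_prop
      simpa using (this.tendsto 0).mono_left nhdsWithin_le_nhds
    filter_upwards [self_mem_nhdsWithin, hcont.eventually_lt_const hy] with u hu hlt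
    exact lt_of_le_of_lt (EReal.coe_le_coe_iff.mpr ((hazardQuantile_le_iff hG hu y).mpr hlt.le)) hya
  · filter_upwards [self_mem_nhdsWithin] with u hu
    exact (hazardQuantile_mem_openSupport hG hu).1

variable [IsProbabilityMeasure ν]

lemma measure_Ioi_eq_one_sub_cdf (y : ℝ) : ν (Set.Ioi y) = ENNReal.ofReal (1 - cdf ν y) := by
  rw [← Set.compl_Iic, prob_compl_eq_one_sub measurableSet_Iic, ← ofReal_cdf,
    ENNReal.ofReal_sub _ (cdf_nonneg ν y), ENNReal.ofReal_one]

lemma measure_Ioi_hazardQuantile (hG : Continuous (cdf ν)) {u : ℝ} (hu : 0 < u) :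
    ν (Set.Ioi (hazardQuantile ν u)) = ENNReal.ofReal (Real.exp (-u)) := by
  rw [measure_Ioi_eq_one_sub_cdf, cdf_hazardQuantile hG hu, sub_sub_cancel]

lemma lintegral_exp_neg_Ioi (a : ℝ) :
    ∫⁻ u in Set.Ioi a, ENNReal.ofReal (Real.exp (-u)) = ENNReal.ofReal (Real.exp (-a)) := by
  rw [← ofReal_integral_eq_lintegral_ofReal, integral_exp_neg_Ioi]
  · exact integrableOn_exp_neg_Ioi a
  · exact .of_forall fun u => (Real.exp_pos _).le

/-- The law `ν` is the image of the standard exponential law. -/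
lemma map_hazardQuantile_exp (hG : Continuous (cdf ν)) :
    ((volume.restrict (Set.Ioi 0)).withDensity fun u => ENNReal.ofReal (Real.exp (-u))).map
      (hazardQuantile ν) = ν := by
  set E := (volume.restrict (Set.Ioi (0 : ℝ))).withDensity fun u => ENNReal.ofReal (Real.exp (-u))
    with hE
  have hEIoi : ∀ a, 0 ≤ a → E (Set.Ioi a) = ENNReal.ofReal (Real.exp (-a)) := by
    intro a ha
    rw [hE, withDensity_apply _ measurableSet_Ioi, Measure.restrict_restrict measurableSet_Ioi,
      Set.Ioi_inter_Ioi, max_eq_left ha, lintegral_exp_neg_Ioi]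
  have hE0 : E (Set.Iic 0) = 0 := by
    rw [hE, withDensity_apply _ measurableSet_Iic, Measure.restrict_restrict measurableSet_Iic]
    simp [Set.Iic_inter_Ioi]
  have hEprob : IsProbabilityMeasure E := ⟨by
    rw [← Set.Iic_union_Ioi (a := (0 : ℝ)), measure_union (by simp) measurableSet_Ioi, hE0,
      hEIoi 0 le_rfl]
    simp⟩
  have hq := measurable_hazardQuantile hG
  have : IsProbabilityMeasure (E.map (hazardQuantile ν)) :=
    Measure.isProbabilityMeasure_map hq.aemeasurable
  refine Measure.ext_of_Iic _ _ fun y => ?_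
  -- Both laws have mass one, so it suffices to compare them on `Ioi y`.
  refine (ENNReal.add_left_inj (measure_ne_top ν (Set.Ioi y))).mp ?_
  rw [← measure_union (by simp) measurableSet_Ioi, Set.Iic_union_Ioi, measure_univ]
  have key : E.map (hazardQuantile ν) (Set.Ioi y) = ν (Set.Ioi y) := by
    rw [Measure.map_apply hq measurableSet_Ioi, measure_Ioi_eq_one_sub_cdf]
    rcases (cdf_le_one ν y).lt_or_eq with hlt | heq
    · have hpos : 0 ≤ cumHazard ν y :=
        neg_nonneg.mpr (Real.log_nonpos (by linarith) (by linarith [cdf_nonneg ν y]))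
      rw [← exp_neg_cumHazard hlt, ← hEIoi _ hpos]
      refine measure_congr ?_
      filter_upwards [show ∀ᵐ u ∂E, u ∈ Set.Ioi (0 : ℝ) by
        rw [ae_iff]; simpa [← Set.Iic_def] using hE0] with u hu
      refine propext ?_
      change y < hazardQuantile ν u ↔ cumHazard ν y < u
      rw [← not_le, hazardQuantile_le_iff hG hu, not_le, ← neg_lt_neg_iff (a := u),
        ← Real.exp_lt_exp (x := -u), exp_neg_cumHazard hlt]
      constructor <;> intro h <;> linarith
    -- Here `cumHazard ν y` is `-log 0 = 0` instead of infinity, so this case is separate: no `u >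
    -- 0` has its quantile above `y`.
    · rw [heq, sub_self, ENNReal.ofReal_zero]
      refine measure_mono_null (fun u hu => ?_) hE0
      by_contra hu0
      have hu0' : 0 < u := not_le.mp hu0
      refine not_le.mpr hu ((hazardQuantile_le_iff hG hu0' y).mpr ?_)
      rw [heq]
      exact (one_sub_exp_neg_mem_Ioo hu0').2.le
  rw [← key, ← measure_union (by simp) measurableSet_Ioi, Set.Iic_union_Ioi, measure_univ]

lemma lintegral_eq_lintegral_hazardQuantile (hG : Continuous (cdf ν)) {f : ℝ → ENNReal}
    (hf : Measurable f) :
    ∫⁻ y, f y ∂ν =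
      ∫⁻ u in Set.Ioi 0, ENNReal.ofReal (Real.exp (-u)) * f (hazardQuantile ν u) := by
  have hq := measurable_hazardQuantile hG
  conv_lhs => rw [← map_hazardQuantile_exp hG]
  rw [lintegral_map hf hq, lintegral_withDensity_eq_lintegral_mul _ (by fun_prop)
    (show Measurable fun u => f (hazardQuantile ν u) from hf.comp hq)]
  rfl

/-- Memorylessness of the exponential law: conditioning `ν` to exceed the quantile of `u` amounts to
adding a fresh standard exponential to `u`. -/
lemma setLIntegral_Ioi_hazardQuantile (hG : Continuous (cdf ν)) {f : ℝ → ENNReal}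
    (hf : Measurable f) {u : ℝ} (hu : 0 < u) :
    (ν (Set.Ioi (hazardQuantile ν u)))⁻¹ * ∫⁻ y in Set.Ioi (hazardQuantile ν u), f y ∂ν =
      ∫⁻ v in Set.Ioi u, ENNReal.ofReal (Real.exp (-(v - u))) * f (hazardQuantile ν v) := by
  have hq := measurable_hazardQuantile hG
  have hmeas : Measurable fun v => ENNReal.ofReal (Real.exp (-v)) *
      (Set.Ioi (hazardQuantile ν u)).indicator f (hazardQuantile ν v) :=
    Measurable.mul (by fun_prop) ((hf.indicator measurableSet_Ioi).comp hq)
  rw [← lintegral_indicator measurableSet_Ioi,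
    lintegral_eq_lintegral_hazardQuantile hG (hf.indicator measurableSet_Ioi),
    measure_Ioi_hazardQuantile hG hu, ← ENNReal.ofReal_inv_of_pos (Real.exp_pos _),
    ← Real.exp_neg, neg_neg, ← lintegral_const_mul _ hmeas,
    ← lintegral_indicator measurableSet_Ioi, ← lintegral_indicator measurableSet_Ioi]
  refine lintegral_congr fun v => ?_
  by_cases hv : 0 < v
  · by_cases huv : u < v
    · have h1 : hazardQuantile ν u < hazardQuantile ν v := (hazardQuantile_lt_iff hG hu hv).mpr huv
      simp only [Set.indicator, Set.mem_Ioi, hv, huv, h1, if_true]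
      rw [← mul_assoc, ← ENNReal.ofReal_mul (Real.exp_pos _).le, ← Real.exp_add]
      ring_nf
    · have h1 : ¬ hazardQuantile ν u < hazardQuantile ν v := by
        rwa [hazardQuantile_lt_iff hG hu hv]
      simp [Set.indicator, huv, h1]
  · have huv : ¬ u < v := fun h => hv (hu.trans h)
    simp [Set.indicator, hv, huv]

end Quantile

/-! ### Regeneration of an i.i.d. sequence at its first exceedance of a level. -/

/-- From a level `s.1` and a sequence `s.2`, pass to the first entry of the sequence above the level
and to the sequence of the later entries. -/
noncomputable def nextRecord (s : ℝ × (ℕ → ℝ)) : ℝ × (ℕ → ℝ) :=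
  (s.2 (sInf {i | s.1 < s.2 i}), fun j => s.2 (sInf {i | s.1 < s.2 i} + 1 + j))

section Regeneration

lemma measurable_sInf_exceedance :
    Measurable fun s : ℝ × (ℕ → ℝ) => sInf {i | s.1 < s.2 i} := by
  have hlt : ∀ i : ℕ, MeasurableSet {s : ℝ × (ℕ → ℝ) | s.1 < s.2 i} := fun i =>
    measurableSet_lt measurable_fst ((measurable_pi_apply i).comp measurable_snd)
  refine measurable_of_Iic fun n => ?_
  -- The infimum of the empty set is `0`, so sequences without an exceedance belong to every
  -- preimage.
  have : (fun s : ℝ × (ℕ → ℝ) => sInf {i | s.1 < s.2 i}) ⁻¹' Set.Iic n =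
      (⋃ i ∈ Set.Iic n, {s | s.1 < s.2 i}) ∪ (⋂ i : ℕ, {s | s.1 < s.2 i}ᶜ) := by
    ext s
    simp only [Set.mem_preimage, Set.mem_Iic, Set.mem_union, Set.mem_iUnion, Set.mem_iInter,
      Set.mem_compl_iff, Set.mem_ofPred_eq, exists_prop]
    constructor
    · intro h
      by_cases hne : {i | s.1 < s.2 i}.Nonempty
      · exact Or.inl ⟨_, h, Nat.sInf_mem hne⟩
      · exact Or.inr fun i hi => hne ⟨i, hi⟩
    · rintro (⟨i, hi, hs⟩ | h)
      · exact (Nat.sInf_le hs).trans hi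
      · have : {i | s.1 < s.2 i} = ∅ := Set.eq_empty_of_forall_notMem h
        simp [this]
  rw [this]
  exact (MeasurableSet.biUnion (Set.to_countable _) fun i _ => hlt i).union
    (MeasurableSet.iInter fun i => (hlt i).compl)

lemma measurable_nextRecord : Measurable nextRecord := by
  have heval : ∀ j : ℕ, Measurable fun p : ℕ × (ℝ × (ℕ → ℝ)) => p.2.2 (p.1 + j) := fun j =>
    measurable_from_prod_countable_right fun i => (measurable_pi_apply (i + j)).comp measurable_snd
  have hpair := measurable_sInf_exceedance.prodMk
    (measurable_id (α := ℝ × (ℕ → ℝ)))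
  refine Measurable.prodMk ((heval 0).comp hpair) (measurable_pi_lambda _ fun j => ?_)
  simpa only [add_assoc] using! (heval (1 + j)).comp hpair

lemma nextRecord_of_lt {x : ℝ} {t : ℕ → ℝ} (h : x < t 0) :
    nextRecord (x, t) = (t 0, fun j => t (j + 1)) := by
  have : sInf {i | x < t i} = 0 := Nat.sInf_eq_zero.mpr (Or.inl h)
  simp only [nextRecord, this]
  exact Prod.ext rfl (funext fun j => congrArg t (by omega))

lemma nextRecord_of_le {x : ℝ} {t : ℕ → ℝ} (h : t 0 ≤ x) (hex : ∃ i, x < t i) :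
    nextRecord (x, t) = nextRecord (x, fun j => t (j + 1)) := by
  have h1 : 1 ≤ sInf {i | x < t i} := by
    by_contra hlt
    have h0 := Nat.sInf_mem (s := {i | x < t i}) hex
    rw [show sInf {i | x < t i} = 0 by omega] at h0
    exact not_lt.mpr h h0
  have : sInf {i | x < t i} = sInf {i | x < t (i + 1)} + 1 := (Nat.sInf_add h1).symm
  simp only [nextRecord, this]
  exact Prod.ext rfl (funext fun j => congrArg t (by omega))

lemma measurable_head_tail : Measurable fun t : ℕ → ℝ => (t 0, fun j => t (j + 1)) :=
  (measurable_pi_apply 0).prodMk (measurable_pi_lambda _ fun j => measurable_pi_apply (j + 1))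

variable (ν : Measure ℝ) [IsProbabilityMeasure ν]

/-- Prepending an independent entry reproduces the product measure, as cylinders show; splitting off
the head inverts prepending. -/
lemma infinitePi_map_head_tail :
    (Measure.infinitePi fun _ : ℕ => ν).map (fun t => (t 0, fun j => t (j + 1))) =
      ν.prod (Measure.infinitePi fun _ : ℕ => ν) := by
  set μ := Measure.infinitePi fun _ : ℕ => ν
  let cons : ℝ × (ℕ → ℝ) → ℕ → ℝ := fun p i => Nat.casesOn i p.1 p.2
  have hcons : Measurable cons := by
    refine measurable_pi_lambda _ fun i => ?_
    cases i with
    | zero => exact measurable_fst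
    | succ i => exact (measurable_pi_apply i).comp measurable_snd
  have hμ : (ν.prod μ).map cons = μ := by
    refine Measure.eq_infinitePi _ fun s t ht => ?_
    obtain ⟨N, hN⟩ : ∃ N, s ⊆ Finset.range (N + 1) :=
      ⟨s.sup id, fun i hi => Finset.mem_range.mpr (Nat.lt_succ_of_le (Finset.le_sup (f := id) hi))⟩
    classical
    -- Padding with `univ` turns the cylinder into one over a full initial segment, from which index
    -- `0` can be split off.
    let t' : ℕ → Set ℝ := fun i => if i ∈ s then t i else Set.univ
    have ht' : ∀ i, MeasurableSet (t' i) := fun i => by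
      by_cases hi : i ∈ s <;> simp [t', hi, ht]
    have hpre : cons ⁻¹' (Set.pi s t) =
        t' 0 ×ˢ Set.pi (Finset.range N) (fun i => t' (i + 1)) := by
      ext p
      simp only [Set.mem_preimage, Set.mem_pi, Finset.mem_coe, Set.mem_prod, Finset.mem_range]
      constructor
      · intro h
        refine ⟨?_, fun i _ => ?_⟩
        · by_cases hi : 0 ∈ s
          · simpa [t', hi] using! h 0 hi
          · simp [t', hi]
        · by_cases hi : i + 1 ∈ s
          · simpa [t', hi] using! h (i + 1) hi
          · simp [t', hi]
      · rintro ⟨h0, h1⟩ i hi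
        cases i with
        | zero => simpa [t', hi] using! h0
        | succ i =>
          simpa [t', hi] using! h1 i (by have := Finset.mem_range.mp (hN hi); omega)
    rw [Measure.map_apply hcons (MeasurableSet.pi s.countable_toSet fun i _ => ht i), hpre,
      Measure.prod_prod, Measure.infinitePi_pi _ fun i _ => ht' (i + 1), mul_comm,
      ← Finset.prod_range_succ' (fun i => ν (t' i)) N]
    symm
    rw [← Finset.prod_subset hN fun i _ hi => by simp [t', hi]]
    exact Finset.prod_congr rfl fun i hi => by simp [t', hi]
  conv_lhs => rw [← hμ]
  rw [Measure.map_map measurable_head_tail hcons]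
  exact Measure.map_id

/-- Splitting off the first entry shows that this probability `p` satisfies `p = ν (Iic x) * p`,
where `ν (Iic x) < 1`. -/
lemma infinitePi_forall_le_eq_zero {x : ℝ} (hx : ν (Set.Ioi x) ≠ 0) :
    Measure.infinitePi (fun _ : ℕ => ν) {t | ∀ i, t i ≤ x} = 0 := by
  set μ := Measure.infinitePi fun _ : ℕ => ν
  have hmeas : MeasurableSet {t : ℕ → ℝ | ∀ i, t i ≤ x} := by
    rw [Set.ofPred_forall]
    exact MeasurableSet.iInter fun i => measurableSet_le (measurable_pi_apply i) measurable_const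
  have hpre : {t : ℕ → ℝ | ∀ i, t i ≤ x} =
      (fun t : ℕ → ℝ => (t 0, fun j => t (j + 1))) ⁻¹' (Set.Iic x ×ˢ {t | ∀ i, t i ≤ x}) := by
    ext t
    refine ⟨fun h => ⟨h 0, fun i => h (i + 1)⟩, fun h i => ?_⟩
    cases i with
    | zero => exact h.1
    | succ i => exact h.2 i
  have hfix : μ {t | ∀ i, t i ≤ x} = ν (Set.Iic x) * μ {t | ∀ i, t i ≤ x} := by
    conv_lhs => rw [hpre]
    rw [← Measure.map_apply measurable_head_tail (measurableSet_Iic.prod hmeas),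
      infinitePi_map_head_tail, Measure.prod_prod]
  have hsum : ν (Set.Iic x) + ν (Set.Ioi x) = 1 := by
    rw [← measure_union (by simp) measurableSet_Ioi, Set.Iic_union_Ioi, measure_univ]
  have h0 : ν (Set.Ioi x) * μ {t | ∀ i, t i ≤ x} = 0 := by
    refine (ENNReal.add_right_inj (measure_ne_top μ {t | ∀ i, t i ≤ x})).mp ?_
    calc _ = ν (Set.Iic x) * μ {t | ∀ i, t i ≤ x} + ν (Set.Ioi x) * μ {t | ∀ i, t i ≤ x} := by
          rw [← hfix]
      _ = _ := by rw [← add_mul, hsum, one_mul, add_zero]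
  exact (mul_eq_zero.mp h0).resolve_left hx

/-- Beyond a level that can be exceeded, the next record has the law `ν` conditioned to lie above the
level, and is independent of the later entries, which are again an i.i.d. sequence. -/
lemma infinitePi_map_nextRecord {x : ℝ} (hx : ν (Set.Ioi x) ≠ 0) :
    (Measure.infinitePi fun _ : ℕ => ν).map (fun t => nextRecord (x, t)) =
      (ν (Set.Ioi x))⁻¹ •
        (ν.restrict (Set.Ioi x)).prod (Measure.infinitePi fun _ : ℕ => ν) := by
  set μ := Measure.infinitePi fun _ : ℕ => ν
  have hnext : Measurable fun t => nextRecord (x, t) :=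
    measurable_nextRecord.comp measurable_prodMk_left
  ext A hA
  rw [Measure.map_apply hnext hA, Measure.smul_apply, smul_eq_mul]
  set I := μ ((fun t => nextRecord (x, t)) ⁻¹' A) with hI
  set B := ((ν.restrict (Set.Ioi x)).prod μ) A with hB
  have hpre : (fun t => nextRecord (x, t)) ⁻¹' A =ᵐ[μ]
      (fun t : ℕ → ℝ => (t 0, fun j => t (j + 1))) ⁻¹'
        ((A ∩ Set.Ioi x ×ˢ Set.univ) ∪ Set.Iic x ×ˢ ((fun t => nextRecord (x, t)) ⁻¹' A)) := by
    filter_upwards [show ∀ᵐ t ∂μ, ∃ i, x < t i by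
      rw [ae_iff]; simpa using infinitePi_forall_le_eq_zero ν hx] with t hex
    refine propext ?_
    change nextRecord (x, t) ∈ A ↔ ((t 0, fun j => t (j + 1)) ∈ A ∧ (x < t 0 ∧ True)) ∨
      (t 0 ≤ x ∧ nextRecord (x, fun j => t (j + 1)) ∈ A)
    rcases lt_or_ge x (t 0) with h | h
    · rw [nextRecord_of_lt h]
      simp [h, h.not_ge]
    · rw [nextRecord_of_le h hex]
      simp [h, h.not_gt]
  have hprod : MeasurableSet (Set.Iic x ×ˢ ((fun t => nextRecord (x, t)) ⁻¹' A)) :=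
    measurableSet_Iic.prod (hnext hA)
  -- Renewal equation: the first entry either exceeds `x`, or is discarded and the search restarts
  -- on an independent copy.
  have hfix : I = B + ν (Set.Iic x) * I := by
    conv_lhs => rw [hI, measure_congr hpre]
    rw [← Measure.map_apply measurable_head_tail
      ((hA.inter (measurableSet_Ioi.prod .univ)).union hprod), infinitePi_map_head_tail,
      measure_union _ hprod, Measure.prod_prod]
    · congr 1
      rw [hB, ← Measure.restrict_apply hA, ← Measure.prod_restrict, Measure.restrict_univ]
    · rw [Set.disjoint_left]
      rintro p ⟨-, hp, -⟩ ⟨hp', -⟩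
      exact not_lt.mpr (Set.mem_Iic.mp hp') (Set.mem_Ioi.mp hp)
  have hsum : ν (Set.Ioi x) + ν (Set.Iic x) = 1 := by
    rw [add_comm, ← measure_union (by simp) measurableSet_Ioi, Set.Iic_union_Ioi, measure_univ]
  have hIB : ν (Set.Ioi x) * I = B := by
    refine (ENNReal.add_left_inj (ENNReal.mul_ne_top (measure_ne_top ν (Set.Iic x))
      (measure_ne_top μ ((fun t => nextRecord (x, t)) ⁻¹' A)))).mp ?_
    rw [← hfix, ← add_mul, hsum, one_mul]
  rw [← hIB, ← mul_assoc, ENNReal.inv_mul_cancel hx (measure_ne_top ν _), one_mul]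

end Regeneration

/-! ### Record values as sums of exponentials in the hazard scale. -/

/-- The density of the sum of `m + 1` independent standard exponential variables. -/
noncomputable def erlangDensity (m : ℕ) (r : ℝ) : ENNReal :=
  ENNReal.ofReal (r ^ m / m.factorial * Real.exp (-r))

/-- The `(m + 1)`-st record value of the sequence `t 0, t 1, …`, with the entries after it. -/
noncomputable def recordState (m : ℕ) (t : ℕ → ℝ) : ℝ × (ℕ → ℝ) :=
  nextRecord^[m] (t 0, fun j => t (j + 1))

section Chain

lemma measurable_erlangDensity (m : ℕ) : Measurable (erlangDensity m) := by
  unfold erlangDensity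
  fun_prop

lemma measurable_recordState (m : ℕ) : Measurable (recordState m) :=
  (measurable_nextRecord.iterate m).comp measurable_head_tail

lemma recordState_add (m l : ℕ) (t : ℕ → ℝ) :
    recordState (m + l) t = nextRecord^[l] (recordState m t) := by
  rw [recordState, add_comm, Function.iterate_add_apply, recordState]

lemma lintegral_Ioi_Ioi_swap {K : ℝ → ℝ → ENNReal} (hK : Measurable (Function.uncurry K)) (u : ℝ) :
    ∫⁻ v in Set.Ioi u, ∫⁻ z in Set.Ioi v, K v z =
      ∫⁻ z in Set.Ioi u, ∫⁻ v in Set.Ioo u z, K v z := by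
  have hset : MeasurableSet {p : ℝ × ℝ | u < p.1 ∧ p.1 < p.2} :=
    (measurableSet_lt measurable_const measurable_fst).inter
      (measurableSet_lt measurable_fst measurable_snd)
  have hind : Measurable (Function.uncurry fun v z : ℝ =>
      {p : ℝ × ℝ | u < p.1 ∧ p.1 < p.2}.indicator (Function.uncurry K) (v, z)) :=
    hK.indicator hset
  have h1 : ∫⁻ v in Set.Ioi u, ∫⁻ z in Set.Ioi v, K v z =
      ∫⁻ v, ∫⁻ z, {p : ℝ × ℝ | u < p.1 ∧ p.1 < p.2}.indicator (Function.uncurry K) (v, z) := by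
    rw [← lintegral_indicator measurableSet_Ioi]
    refine lintegral_congr fun v => ?_
    by_cases hv : u < v
    · simp only [Set.indicator, Set.mem_Ioi, hv, if_true]
      rw [← lintegral_indicator measurableSet_Ioi]
      refine lintegral_congr fun z => ?_
      simp [Set.indicator, hv]
    · simp [Set.indicator, hv]
  have h2 : ∫⁻ z in Set.Ioi u, ∫⁻ v in Set.Ioo u z, K v z =
      ∫⁻ z, ∫⁻ v, {p : ℝ × ℝ | u < p.1 ∧ p.1 < p.2}.indicator (Function.uncurry K) (v, z) := by
    rw [← lintegral_indicator measurableSet_Ioi]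
    refine lintegral_congr fun z => ?_
    by_cases hz : u < z
    · simp only [Set.indicator, Set.mem_Ioi, hz, if_true]
      rw [← lintegral_indicator measurableSet_Ioo]
      refine lintegral_congr fun v => ?_
      simp [Set.indicator]
    · have : ∀ v, ¬ (u < v ∧ v < z) := fun v h => hz (h.1.trans h.2)
      simp [Set.indicator, hz, this]
  rw [h1, h2, lintegral_lintegral_swap hind.aemeasurable]

lemma lintegral_Ioo_sub_pow (m : ℕ) {u z : ℝ} (huz : u < z) :
    ∫⁻ v in Set.Ioo u z, ENNReal.ofReal ((v - u) ^ m) =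
      ENNReal.ofReal ((z - u) ^ (m + 1) / (m + 1)) := by
  rw [setLIntegral_congr Ioo_ae_eq_Ioc, ← ofReal_integral_eq_lintegral_ofReal,
    ← intervalIntegral.integral_of_le huz.le,
    intervalIntegral.integral_comp_sub_right (fun x : ℝ => x ^ m), integral_pow]
  · simp
  · rw [← IntegrableOn, ← intervalIntegrable_iff_integrableOn_Ioc_of_le huz.le]
    exact Continuous.intervalIntegrable (by fun_prop) _ _
  · filter_upwards [ae_restrict_mem measurableSet_Ioc] with v hv
    exact pow_nonneg (by linarith [hv.1]) m

/-- The exponentials combine to a factor free of `v`. The remaining power of `v - u` yields both the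
Erlang convolution and the conditional law of the intermediate point. -/
lemma erlangDensity_mul_zero (m : ℕ) {u v z : ℝ} (huv : u < v) :
    erlangDensity m (v - u) * erlangDensity 0 (z - v) =
      ENNReal.ofReal (Real.exp (-(z - u)) / m.factorial) * ENNReal.ofReal ((v - u) ^ m) := by
  have h : 0 ≤ (v - u) ^ m := pow_nonneg (by linarith) m
  rw [erlangDensity, erlangDensity, ← ENNReal.ofReal_mul (by positivity),
    ← ENNReal.ofReal_mul (by positivity), show -(z - u) = -(v - u) + -(z - v) by ring,
    Real.exp_add]
  congr 1
  simp
  ring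

lemma lintegral_erlangDensity_mul_zero (m : ℕ) {u z : ℝ} (huz : u < z) :
    ∫⁻ v in Set.Ioo u z, erlangDensity m (v - u) * erlangDensity 0 (z - v) =
      erlangDensity (m + 1) (z - u) := by
  rw [setLIntegral_congr_fun measurableSet_Ioo fun v hv => erlangDensity_mul_zero m hv.1,
    lintegral_const_mul _ (by fun_prop), lintegral_Ioo_sub_pow m huz,
    ← ENNReal.ofReal_mul (by positivity), erlangDensity, Nat.factorial_succ]
  congr 1
  push_cast
  field_simp

lemma lintegral_erlangDensity_succ {φ : ℝ → ENNReal} (hφ : Measurable φ) (m : ℕ) (u : ℝ) :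
    ∫⁻ v in Set.Ioi u, erlangDensity m (v - u) *
        ∫⁻ z in Set.Ioi v, erlangDensity 0 (z - v) * φ z =
      ∫⁻ z in Set.Ioi u, erlangDensity (m + 1) (z - u) * φ z := by
  have hm := measurable_erlangDensity m
  have h0 := measurable_erlangDensity 0
  calc _ = ∫⁻ v in Set.Ioi u, ∫⁻ z in Set.Ioi v,
        erlangDensity m (v - u) * (erlangDensity 0 (z - v) * φ z) := by
        refine lintegral_congr fun v => ?_
        rw [lintegral_const_mul _ (by fun_prop)]
    _ = _ := lintegral_Ioi_Ioi_swap (by simp only [Function.uncurry_def]; fun_prop) u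
    _ = _ := by
        refine setLIntegral_congr_fun measurableSet_Ioi fun z hz => ?_
        simp only [← mul_assoc]
        rw [lintegral_mul_const _ (by fun_prop), lintegral_erlangDensity_mul_zero m hz]

variable {ν : Measure ℝ} [IsProbabilityMeasure ν]

lemma lintegral_nextRecord_hazardQuantile (hG : Continuous (cdf ν))
    {F : ℝ × (ℕ → ℝ) → ENNReal} (hF : Measurable F) {u : ℝ} (hu : 0 < u) :
    ∫⁻ t, F (nextRecord (hazardQuantile ν u, t)) ∂(Measure.infinitePi fun _ : ℕ => ν) =
      ∫⁻ v in Set.Ioi u, erlangDensity 0 (v - u) *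
        ∫⁻ t, F (hazardQuantile ν v, t) ∂(Measure.infinitePi fun _ : ℕ => ν) := by
  have hnext : Measurable fun t => nextRecord (hazardQuantile ν u, t) :=
    measurable_nextRecord.comp measurable_prodMk_left
  have hν : ν (Set.Ioi (hazardQuantile ν u)) ≠ 0 := by
    rw [measure_Ioi_hazardQuantile hG hu]
    simpa using Real.exp_pos (-u)
  rw [← lintegral_map hF hnext, infinitePi_map_nextRecord ν hν, lintegral_smul_measure,
    lintegral_prod _ hF.aemeasurable, smul_eq_mul,
    setLIntegral_Ioi_hazardQuantile hG hF.lintegral_prod_right' hu]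
  simp [erlangDensity]

/-- The record process started at level `q u`: record values, in the scale of the hazard quantile
`q`, increase by independent standard exponential variables. -/
lemma lintegral_iterate_nextRecord (hG : Continuous (cdf ν)) (m : ℕ)
    {F : ℝ × (ℕ → ℝ) → ENNReal} (hF : Measurable F) {u : ℝ} (hu : 0 < u) :
    ∫⁻ t, F (nextRecord^[m + 1] (hazardQuantile ν u, t)) ∂(Measure.infinitePi fun _ : ℕ => ν) =
      ∫⁻ v in Set.Ioi u, erlangDensity m (v - u) *
        ∫⁻ t, F (hazardQuantile ν v, t) ∂(Measure.infinitePi fun _ : ℕ => ν) := by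
  induction m generalizing F with
  | zero => exact lintegral_nextRecord_hazardQuantile hG hF hu
  | succ m ih =>
    have hq := measurable_hazardQuantile hG
    simp only [Function.iterate_succ_apply' nextRecord (m + 1)]
    rw [ih (F := fun s => F (nextRecord s)) (hF.comp measurable_nextRecord)]
    refine Eq.trans ?_ (lintegral_erlangDensity_succ (hF.lintegral_prod_right'
      (ν := Measure.infinitePi fun _ : ℕ => ν).comp hq) m u)
    refine setLIntegral_congr_fun measurableSet_Ioi fun v hv => ?_
    dsimp only [Function.comp]
    rw [lintegral_nextRecord_hazardQuantile hG hF (hu.trans hv)]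

/-- The first entry acts as a jump from hazard level `0`. It needs its own base case, since
`hazardQuantile ν 0` is a default value and not the left extremity. -/
lemma lintegral_recordState (hG : Continuous (cdf ν)) (m : ℕ)
    {F : ℝ × (ℕ → ℝ) → ENNReal} (hF : Measurable F) :
    ∫⁻ t, F (recordState m t) ∂(Measure.infinitePi fun _ : ℕ => ν) =
      ∫⁻ u in Set.Ioi 0, erlangDensity m u *
        ∫⁻ t, F (hazardQuantile ν u, t) ∂(Measure.infinitePi fun _ : ℕ => ν) := by
  induction m generalizing F with
  | zero =>
    have := lintegral_map (μ := Measure.infinitePi fun _ : ℕ => ν) hF measurable_head_tail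
    rw [infinitePi_map_head_tail, lintegral_prod _ hF.aemeasurable,
      lintegral_eq_lintegral_hazardQuantile hG hF.lintegral_prod_right'] at this
    simpa [recordState, erlangDensity] using this.symm
  | succ m ih =>
    have hq := measurable_hazardQuantile hG
    simp only [recordState_add, Function.iterate_one]
    have hs := lintegral_erlangDensity_succ (hF.lintegral_prod_right'
      (ν := Measure.infinitePi fun _ : ℕ => ν).comp hq) m 0
    simp only [sub_zero] at hs
    rw [ih (F := fun s => F (nextRecord s)) (hF.comp measurable_nextRecord)]
    refine Eq.trans ?_ hs
    refine setLIntegral_congr_fun measurableSet_Ioi fun v hv => ?_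
    dsimp only [Function.comp]
    rw [lintegral_nextRecord_hazardQuantile hG hF hv]

lemma lintegral_recordState_pair (hG : Continuous (cdf ν)) (i m : ℕ)
    {f : ℝ × ℝ → ENNReal} (hf : Measurable f) :
    ∫⁻ t, f ((recordState i t).1, (recordState (i + (m + 1)) t).1)
        ∂(Measure.infinitePi fun _ : ℕ => ν) =
      ∫⁻ u in Set.Ioi 0, erlangDensity i u * ∫⁻ z in Set.Ioi u, erlangDensity m (z - u) *
        f (hazardQuantile ν u, hazardQuantile ν z) := by
  simp only [recordState_add]
  have hit := measurable_nextRecord.iterate (m + 1)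
  rw [lintegral_recordState hG i (F := fun s => f (s.1, (nextRecord^[m + 1] s).1)) (by fun_prop)]
  refine setLIntegral_congr_fun measurableSet_Ioi fun u hu => ?_
  dsimp only
  rw [lintegral_iterate_nextRecord hG m (F := fun s => f (hazardQuantile ν u, s.1))
    (by fun_prop) hu]
  simp

/-- The intermediate point `v` is integrated innermost, so that its conditional law given the outer
pair can be read off. -/
lemma lintegral_recordState_triple (hG : Continuous (cdf ν)) (i m : ℕ)
    {f : (ℝ × ℝ) × ℝ → ENNReal} (hf : Measurable f) :
    ∫⁻ t, f (((recordState i t).1, (recordState (i + (m + 1) + 1) t).1),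
        (recordState (i + (m + 1)) t).1) ∂(Measure.infinitePi fun _ : ℕ => ν) =
      ∫⁻ u in Set.Ioi 0, erlangDensity i u * ∫⁻ z in Set.Ioi u, ∫⁻ v in Set.Ioo u z,
        erlangDensity m (v - u) * erlangDensity 0 (z - v) *
          f ((hazardQuantile ν u, hazardQuantile ν z), hazardQuantile ν v) := by
  have hq := measurable_hazardQuantile hG
  have hm := measurable_erlangDensity m
  have h0 := measurable_erlangDensity 0
  have hit := measurable_nextRecord.iterate (m + 1)
  have hnext := measurable_nextRecord
  simp only [recordState_add _ 1, recordState_add i (m + 1), Function.iterate_one]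
  rw [lintegral_recordState hG i (F := fun s => f ((s.1, (nextRecord (nextRecord^[m + 1] s)).1),
    (nextRecord^[m + 1] s).1))
    (hf.comp ((measurable_fst.prodMk (hnext.comp hit).fst).prodMk hit.fst))]
  refine setLIntegral_congr_fun measurableSet_Ioi fun u hu => ?_
  dsimp only
  rw [lintegral_iterate_nextRecord hG m (F := fun s => f ((hazardQuantile ν u, (nextRecord s).1),
    s.1)) (hf.comp ((measurable_const.prodMk hnext.fst).prodMk measurable_fst)) hu,
    ← lintegral_Ioi_Ioi_swap (by simp only [Function.uncurry_def]; fun_prop)]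
  congr 1
  refine setLIntegral_congr_fun measurableSet_Ioi fun v hv => ?_
  dsimp only
  rw [lintegral_nextRecord_hazardQuantile hG (F := fun s => f ((hazardQuantile ν u, s.1),
    hazardQuantile ν v)) (by fun_prop) (lt_trans hu hv), ← lintegral_const_mul _ (by fun_prop)]
  simp [mul_assoc]

/-- Almost sure finiteness of record times: a record at finite hazard level `u` leaves mass `exp
(-u) > 0` above it, and the later entries are again i.i.d. -/
lemma ae_exists_exceedance_recordState (hG : Continuous (cdf ν)) (m : ℕ) :
    ∀ᵐ t ∂(Measure.infinitePi fun _ : ℕ => ν),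
      ∃ i, (recordState m t).1 < (recordState m t).2 i := by
  have hmeas : MeasurableSet {s : ℝ × (ℕ → ℝ) | ∀ i, s.2 i ≤ s.1} := by
    rw [Set.ofPred_forall]
    exact MeasurableSet.iInter fun i =>
      measurableSet_le ((measurable_pi_apply i).comp measurable_snd) measurable_fst
  have h := lintegral_recordState hG m (F := {s : ℝ × (ℕ → ℝ) | ∀ i, s.2 i ≤ s.1}.indicator 1)
    (measurable_one.indicator hmeas)
  have hz : ∫⁻ u in Set.Ioi 0, erlangDensity m u *
      ∫⁻ t, {s : ℝ × (ℕ → ℝ) | ∀ i, s.2 i ≤ s.1}.indicator 1 (hazardQuantile ν u, t)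
        ∂(Measure.infinitePi fun _ : ℕ => ν) = 0 := by
    rw [← lintegral_zero (μ := volume.restrict (Set.Ioi (0 : ℝ)))]
    refine setLIntegral_congr_fun measurableSet_Ioi fun u hu => ?_
    have hν : ν (Set.Ioi (hazardQuantile ν u)) ≠ 0 := by
      rw [measure_Ioi_hazardQuantile hG hu]
      simpa using Real.exp_pos (-u)
    refine mul_eq_zero_of_right _ ?_
    refine (lintegral_indicator_one (measurable_prodMk_left hmeas)).trans ?_
    exact infinitePi_forall_le_eq_zero ν hν
  rw [hz] at h
  rw [ae_iff, ← h]
  refine Eq.trans ?_ (lintegral_indicator_one (measurable_recordState m hmeas)).symm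
  congr 1
  ext t
  simp

end Chain

/-! ### The candidate conditional law. -/

/-- The law of the largest of `m + 1` independent uniform variables on `(0, 1)`. -/
noncomputable def uniformMaxLaw (m : ℕ) : Measure ℝ :=
  (volume.restrict (Set.Ioo 0 1)).withDensity fun b => ENNReal.ofReal ((m + 1) * b ^ m)

/-- The conditional law of a record value, given the record value `m + 1` steps before and the next
record value. -/
noncomputable def recordKernel (ν : Measure ℝ) (m : ℕ) : Kernel (ℝ × ℝ) ℝ :=
  (Kernel.id ×ₖ Kernel.const (ℝ × ℝ) (uniformMaxLaw m)).map fun x : (ℝ × ℝ) × ℝ =>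
    hazardQuantile ν
      (cumHazard ν x.1.1 + (cumHazard ν x.1.2 - cumHazard ν x.1.1) * x.2)

/-! ### Record times as iterated exceedances. -/

section RecordTimes

/-- The hypothesis keeps every infimum away from its default value; the two recursions then differ
only by indexing from `1` instead of `0`. -/
lemma recordState_eq_recordTime {y : ℕ → ℝ}
    (h : ∀ m, ∃ i, (recordState m fun i => y (i + 1)).1 < (recordState m fun i => y (i + 1)).2 i)
    (m : ℕ) :
    recordState m (fun i => y (i + 1)) =
      (y (recordTime y (m + 1)), fun j => y (recordTime y (m + 1) + 1 + j)) := by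
  induction m with
  | zero => exact Prod.ext rfl (funext fun j => congrArg y (by simp only [recordTime]; omega))
  | succ m ih =>
    have hex := h m
    rw [recordState_add m 1, Function.iterate_one, ih]
    rw [ih] at hex
    dsimp only at hex
    set L := recordTime y (m + 1) with hL
    -- `recordTime` counts absolute positions, `nextRecord` the offset from position `L + 1`.
    have hL' : recordTime y (m + 1 + 1) = L + 1 + sInf {i | y L < y (L + 1 + i)} := by
      rw [recordTime, ← hL]
      refine le_antisymm (Nat.sInf_le ⟨by omega, Nat.sInf_mem hex⟩) ?_
      refine le_csInf ⟨_, by omega, Nat.sInf_mem hex⟩ fun j hj => ?_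
      have hj1 : L < j := hj.1
      have : sInf {i | y L < y (L + 1 + i)} ≤ j - (L + 1) := Nat.sInf_le (by
        change y L < y (L + 1 + (j - (L + 1)))
        rw [Nat.add_sub_cancel' hj1]
        exact hj.2)
      omega
    rw [hL', nextRecord]
    exact Prod.ext rfl (funext fun j => congrArg y (by dsimp only; omega))

variable {Ω : Type*} [MeasurableSpace Ω] {P : Measure Ω} {ν : Measure ℝ} {Y : ℕ → Ω → ℝ}

lemma map_shift_eq_infinitePi (hmeas : ∀ i, 1 ≤ i → Measurable (Y i))
    (hlaw : ∀ i, 1 ≤ i → P.map (Y i) = ν) (hindep : iIndepFun (fun i : ℕ => Y (i + 1)) P) :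
    P.map (fun ω i => Y (i + 1) ω) = Measure.infinitePi fun _ : ℕ => ν := by
  rw [hindep.map_fun_eq_infinitePi_map fun i => hmeas (i + 1) (by omega)]
  congr 1
  exact funext fun i => hlaw (i + 1) (by omega)

lemma recordValue_ae_eq_recordState [IsProbabilityMeasure ν] (hmeas : ∀ i, 1 ≤ i → Measurable (Y i))
    (hlaw : ∀ i, 1 ≤ i → P.map (Y i) = ν) (hindep : iIndepFun (fun i : ℕ => Y (i + 1)) P)
    (hG : Continuous (cdf ν)) (m : ℕ) :
    recordValue Y (m + 1) =ᵐ[P] fun ω => (recordState m fun i => Y (i + 1) ω).1 := by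
  have hY : Measurable fun ω (i : ℕ) => Y (i + 1) ω :=
    measurable_pi_lambda _ fun i => hmeas (i + 1) (by omega)
  have h := ae_all_iff.mpr (ae_exists_exceedance_recordState (ν := ν) hG)
  rw [← map_shift_eq_infinitePi hmeas hlaw hindep] at h
  filter_upwards [ae_of_ae_map hY.aemeasurable h] with ω hω
  exact (congrArg Prod.fst (recordState_eq_recordTime (y := fun i => Y i ω) hω m)).symm

end RecordTimes

/-! ### Disintegration of three record values. -/

section Kernel

lemma measurable_pow_density (m : ℕ) :
    Measurable fun b : ℝ => ENNReal.ofReal ((m + 1) * b ^ m) := by fun_prop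

instance (m : ℕ) : IsProbabilityMeasure (uniformMaxLaw m) := ⟨by
  have h := lintegral_Ioo_sub_pow m one_pos
  simp only [sub_zero, one_pow] at h
  have hm : (0 : ℝ) ≤ m + 1 := by positivity
  simp only [uniformMaxLaw, withDensity_apply _ MeasurableSet.univ, Measure.restrict_univ,
    ENNReal.ofReal_mul hm]
  rw [lintegral_const_mul _ (by fun_prop), h, ← ENNReal.ofReal_mul hm]
  rw [mul_one_div_cancel (by positivity), ENNReal.ofReal_one]⟩

lemma ae_uniformMaxLaw_mem_Ioo (m : ℕ) : ∀ᵐ b ∂uniformMaxLaw m, b ∈ Set.Ioo (0 : ℝ) 1 :=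
  (withDensity_absolutelyContinuous _ _).ae_le (ae_restrict_mem measurableSet_Ioo)

lemma lintegral_uniformMaxLaw (m : ℕ) {f : ℝ → ENNReal} (hf : Measurable f) :
    ∫⁻ b, f b ∂uniformMaxLaw m =
      ∫⁻ b in Set.Ioo 0 1, ENNReal.ofReal ((m + 1) * b ^ m) * f b := by
  rw [uniformMaxLaw, lintegral_withDensity_eq_lintegral_mul _ (measurable_pow_density m) hf]
  rfl

lemma integral_uniformMaxLaw (m : ℕ) (f : ℝ → ℝ) :
    ∫ b, f b ∂uniformMaxLaw m = ∫ b in (0 : ℝ)..1, (m + 1) * b ^ m * f b := by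
  rw [uniformMaxLaw, integral_withDensity_eq_integral_toReal_smul (measurable_pow_density m)
    (.of_forall fun b => ENNReal.ofReal_lt_top), intervalIntegral.integral_of_le zero_le_one,
    integral_Ioc_eq_integral_Ioo]
  refine setIntegral_congr_fun measurableSet_Ioo fun b hb => ?_
  have : (0 : ℝ) ≤ (m + 1) * b ^ m := mul_nonneg (by positivity) (pow_nonneg hb.1.le m)
  simp only [ENNReal.toReal_ofReal this, smul_eq_mul]

lemma lintegral_Ioo_eq_lintegral_unit {u z : ℝ} (huz : u < z) (f : ℝ → ENNReal) :
    ∫⁻ v in Set.Ioo u z, f v =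
      ∫⁻ b in Set.Ioo 0 1, ENNReal.ofReal (z - u) * f (u + (z - u) * b) := by
  have hpos : 0 < z - u := sub_pos.mpr huz
  have himg : (fun b => u + (z - u) * b) '' Set.Ioo (0 : ℝ) 1 = Set.Ioo u z := by
    ext v
    constructor
    · rintro ⟨b, ⟨h0, h1⟩, rfl⟩
      constructor <;> dsimp only <;> nlinarith
    · rintro ⟨h0, h1⟩
      refine ⟨(v - u) / (z - u), ⟨div_pos (by linarith) hpos, ?_⟩, ?_⟩
      · rw [div_lt_one hpos]; linarith
      · field_simp; ring
  rw [← himg, lintegral_image_eq_lintegral_abs_deriv_mul (f' := fun _ => z - u) measurableSet_Ioo]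
  · rw [abs_of_pos hpos]
  · intro b _
    exact (((hasDerivAt_id b).const_mul (z - u)).const_add u).hasDerivWithinAt.congr_deriv (by simp)
  · intro a _ b _ hab
    exact mul_left_cancel₀ hpos.ne' (add_left_cancel hab)

variable {ν : Measure ℝ}

lemma recordKernel_apply (hG : Continuous (cdf ν)) (m : ℕ) (p : ℝ × ℝ) :
    recordKernel ν m p = (uniformMaxLaw m).map fun b =>
      hazardQuantile ν (cumHazard ν p.1 + (cumHazard ν p.2 - cumHazard ν p.1) * b) := by
  have hq := measurable_hazardQuantile hG
  have hH := measurable_cumHazard (ν := ν)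
  rw [recordKernel, Kernel.map_apply _ (by fun_prop), Kernel.prod_apply, Kernel.id_apply,
    Kernel.const_apply, Measure.dirac_prod, Measure.map_map (by fun_prop) (by fun_prop)]
  rfl

lemma isMarkovKernel_recordKernel (hG : Continuous (cdf ν)) (m : ℕ) :
    IsMarkovKernel (recordKernel ν m) := by
  have hq := measurable_hazardQuantile hG
  have hH := measurable_cumHazard (ν := ν)
  exact Kernel.IsMarkovKernel.map _ (by fun_prop)

/-- Under `v = u + (z - u) * b` the joint increment density splits into the Erlang density of `z -
u` and the density `(m + 1) * b ^ m`. -/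
lemma lintegral_recordKernel_hazardQuantile (hG : Continuous (cdf ν)) (m : ℕ) {u z : ℝ}
    (hu : 0 < u) (huz : u < z) {f : ℝ → ENNReal} (hf : Measurable f) :
    erlangDensity (m + 1) (z - u) *
        ∫⁻ x, f x ∂recordKernel ν m (hazardQuantile ν u, hazardQuantile ν z) =
      ∫⁻ v in Set.Ioo u z, erlangDensity m (v - u) * erlangDensity 0 (z - v) *
        f (hazardQuantile ν v) := by
  have hq := measurable_hazardQuantile hG
  have hpos : 0 < z - u := sub_pos.mpr huz
  rw [recordKernel_apply hG, lintegral_map hf (by fun_prop)]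
  dsimp only
  rw [cumHazard_hazardQuantile hG hu, cumHazard_hazardQuantile hG (hu.trans huz),
    lintegral_uniformMaxLaw m (by fun_prop), ← lintegral_const_mul _ (by fun_prop),
    lintegral_Ioo_eq_lintegral_unit huz]
  refine setLIntegral_congr_fun measurableSet_Ioo fun b hb => ?_
  have hb0 : 0 < b := hb.1
  rw [erlangDensity_mul_zero m (show u < u + (z - u) * b by nlinarith), ← mul_assoc, ← mul_assoc,
    add_sub_cancel_left, erlangDensity, ← ENNReal.ofReal_mul (by positivity),
    ← ENNReal.ofReal_mul (by positivity), ← ENNReal.ofReal_mul (by positivity), Nat.factorial_succ]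
  congr 2
  push_cast
  field_simp
  rw [mul_pow]
  ring

variable [IsProbabilityMeasure ν]

lemma map_recordState_triple_eq_compProd (hG : Continuous (cdf ν)) (i m : ℕ) :
    (Measure.infinitePi fun _ : ℕ => ν).map (fun t =>
      (((recordState i t).1, (recordState (i + (m + 1) + 1) t).1),
        (recordState (i + (m + 1)) t).1)) =
    ((Measure.infinitePi fun _ : ℕ => ν).map fun t =>
      ((recordState i t).1, (recordState (i + (m + 1) + 1) t).1)) ⊗ₘ recordKernel ν m := by
  have := isMarkovKernel_recordKernel hG m
  have hs := fun j => (measurable_recordState j).fst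
  have hpair := (hs i).prodMk (hs (i + (m + 1) + 1))
  have : IsProbabilityMeasure ((Measure.infinitePi fun _ : ℕ => ν).map fun t =>
      ((recordState i t).1, (recordState (i + (m + 1) + 1) t).1)) :=
    Measure.isProbabilityMeasure_map hpair.aemeasurable
  refine Measure.ext_of_lintegral _ fun f hf => ?_
  rw [lintegral_map hf (hpair.prodMk (hs _)), lintegral_recordState_triple hG i m hf,
    Measure.lintegral_compProd hf, lintegral_map hf.lintegral_kernel_prod_right' hpair]
  rw [add_assoc, lintegral_recordState_pair hG i (m + 1)
    (f := fun p => ∫⁻ x, f (p, x) ∂recordKernel ν m p) hf.lintegral_kernel_prod_right']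
  refine setLIntegral_congr_fun measurableSet_Ioi fun u hu => ?_
  congr 1
  refine setLIntegral_congr_fun measurableSet_Ioi fun z hz => ?_
  exact (lintegral_recordKernel_hazardQuantile hG m hu hz
    (hf.comp measurable_prodMk_left)).symm

/-- A property that holds for almost all pairs of record values holds, in the scale of the hazard
quantile, for almost all pairs of reals `0 < u < z`. -/
lemma ae_ae_of_ae_map_recordState (hG : Continuous (cdf ν)) (i m : ℕ) {p : ℝ × ℝ → Prop}
    (h : ∀ᵐ x ∂(Measure.infinitePi fun _ : ℕ => ν).map (fun t =>
      ((recordState i t).1, (recordState (i + (m + 1)) t).1)), p x) :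
    ∀ᵐ u ∂volume.restrict (Set.Ioi (0 : ℝ)), ∀ᵐ z ∂volume.restrict (Set.Ioi u),
      p (hazardQuantile ν u, hazardQuantile ν z) := by
  have hq := measurable_hazardQuantile hG
  have hm := measurable_erlangDensity m
  have hi := measurable_erlangDensity i
  have hs := fun j => (measurable_recordState j).fst
  have hpair := (hs i).prodMk (hs (i + (m + 1)))
  -- The property `p` need not be measurable, so a measurable null superset replaces its failure
  -- set. Positivity of the Erlang densities then transfers nullity to Lebesgue measure.
  obtain ⟨N, hpN, hN, hN0⟩ := exists_measurable_superset_of_null (ae_iff.mp h)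
  have hint := lintegral_recordState_pair hG i m (f := N.indicator 1) (measurable_one.indicator hN)
  rw [← lintegral_map (measurable_one.indicator hN) hpair, lintegral_indicator_one hN, hN0] at hint
  have hind : Measurable (N.indicator (1 : ℝ × ℝ → ENNReal)) := measurable_one.indicator hN
  have hinner : Measurable fun u => ∫⁻ z in Set.Ioi u, erlangDensity m (z - u) *
      N.indicator 1 (hazardQuantile ν u, hazardQuantile ν z) := by
    have : (fun u => ∫⁻ z in Set.Ioi u, erlangDensity m (z - u) *
        N.indicator 1 (hazardQuantile ν u, hazardQuantile ν z)) = fun u => ∫⁻ z,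
        {x : ℝ × ℝ | x.1 < x.2}.indicator (fun x => erlangDensity m (x.2 - x.1) *
          N.indicator 1 (hazardQuantile ν x.1, hazardQuantile ν x.2)) (u, z) := by
      funext u
      rw [← lintegral_indicator measurableSet_Ioi]
      rfl
    rw [this]
    refine Measurable.lintegral_prod_right' (Measurable.indicator ?_
      (measurableSet_lt measurable_fst measurable_snd))
    fun_prop
  replace hint := (lintegral_eq_zero_iff (hi.mul hinner)).mp hint.symm
  filter_upwards [hint, ae_restrict_mem measurableSet_Ioi] with u hu hu0
  have hu0' : (0 : ℝ) < u := hu0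
  have hui : erlangDensity i u ≠ 0 := by
    rw [erlangDensity, Ne, ENNReal.ofReal_eq_zero, not_le]
    positivity
  have hz0 := (mul_eq_zero.mp hu).resolve_left hui
  rw [lintegral_eq_zero_iff (by fun_prop)] at hz0
  filter_upwards [hz0, ae_restrict_mem measurableSet_Ioi] with z hz hzu
  have hzu' : 0 < z - u := sub_pos.mpr hzu
  have hzm : erlangDensity m (z - u) ≠ 0 := by
    rw [erlangDensity, Ne, ENNReal.ofReal_eq_zero, not_le]
    positivity
  have hnot := (mul_eq_zero.mp hz).resolve_left hzm
  by_contra hcon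
  have hmem : (hazardQuantile ν u, hazardQuantile ν z) ∈ N := hpN hcon
  simp [hmem] at hnot

end Kernel

/-! ### The integral equation forces an affine function. -/

section Affine

/-- A monotone function that agrees almost everywhere with a continuous one agrees everywhere. -/
lemma MonotoneOn.eqOn_Ioi_of_ae_eq {h c : ℝ → ℝ} {u : ℝ} (hmono : MonotoneOn h (Set.Ioi u))
    (hc : ContinuousOn c (Set.Ioi u)) (hae : ∀ᵐ v ∂volume.restrict (Set.Ioi u), h v = c v) :
    Set.EqOn h c (Set.Ioi u) := by
  intro v hv
  have hv' : u < v := hv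
  have hcv : ContinuousAt c v := hc.continuousAt (Ioi_mem_nhds hv)
  have hnear : ∀ a b : ℝ, u ≤ a → a < b → ∃ x ∈ Set.Ioo a b, h x = c x := by
    intro a b hua hab
    by_contra! hcon
    have hsub : Set.Ioo a b ⊆ {x | ¬ (x ∈ Set.Ioi u → h x = c x)} := fun x hx hx' =>
      hcon x hx (hx' (lt_of_le_of_lt hua hx.1))
    rw [ae_restrict_iff' measurableSet_Ioi, ae_iff] at hae
    have := measure_mono_null hsub hae
    rw [Real.volume_Ioo, ENNReal.ofReal_eq_zero] at this
    linarith
  refine le_antisymm ?_ ?_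
  · refine le_of_forall_gt_imp_ge_of_dense fun a ha => ?_
    obtain ⟨b, hvb, hb⟩ : ∃ b, v < b ∧ ∀ x ∈ Set.Ioo v b, c x < a := by
      obtain ⟨b, hb, hb'⟩ := mem_nhdsGT_iff_exists_Ioo_subset.mp
        ((hcv.eventually_lt_const ha).filter_mono nhdsWithin_le_nhds)
      exact ⟨b, hb, hb'⟩
    obtain ⟨x, hx, hxc⟩ := hnear v b hv'.le hvb
    exact (hmono hv (hv'.trans hx.1) hx.1.le).trans (hxc.trans_lt (hb x hx)).le
  · refine le_of_forall_lt_imp_le_of_dense fun a ha => ?_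
    obtain ⟨b, hbv, hb⟩ : ∃ b, b < v ∧ ∀ x ∈ Set.Ioo b v, a < c x := by
      obtain ⟨b, hb, hb'⟩ := mem_nhdsLT_iff_exists_Ioo_subset.mp
        ((hcv.eventually_const_lt ha).filter_mono nhdsWithin_le_nhds)
      exact ⟨b, hb, hb'⟩
    obtain ⟨x, hx, hxc⟩ := hnear (max u b) v (le_max_left _ _) (max_lt hv' hbv)
    have hux : u < x := lt_of_le_of_lt (le_max_left _ _) hx.1
    exact ((hb x ⟨lt_of_le_of_lt (le_max_right _ _) hx.1, hx.2⟩).trans_eq hxc.symm).le.trans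
      (hmono hux hv hx.2.le)

lemma integral_unit_eq_integral_sub_pow (h : ℝ → ℝ) (m : ℕ) {u z : ℝ} (huz : u < z) :
    (z - u) ^ (m + 1) * ∫ b in (0 : ℝ)..1, (m + 1) * b ^ m * h (u + (z - u) * b) =
      (m + 1) * ∫ x in u..z, (x - u) ^ m * h x := by
  have hne : z - u ≠ 0 := (sub_pos.mpr huz).ne'
  have h1 := intervalIntegral.integral_comp_add_mul (a := 0) (b := 1)
    (fun x => (x - u) ^ m * h x) hne u
  have h2 : u + (z - u) * 1 = z := by ring
  have h3 : u + (z - u) * 0 = u := by ring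
  rw [h2, h3, smul_eq_mul] at h1
  have h4 : ∫ x in u..z, (x - u) ^ m * h x =
      (z - u) * ∫ b in (0 : ℝ)..1, (u + (z - u) * b - u) ^ m * h (u + (z - u) * b) := by
    rw [h1, mul_inv_cancel_left₀ hne]
  rw [h4, ← intervalIntegral.integral_const_mul, ← intervalIntegral.integral_const_mul,
    ← intervalIntegral.integral_const_mul]
  refine intervalIntegral.integral_congr fun b _ => ?_
  simp only [add_sub_cancel_left, mul_pow]
  ring

/-- A solution `h` of the regression equation with `u` fixed is affine beyond `u`. -/
lemma eq_affine_of_integral_eq {h : ℝ → ℝ} {u : ℝ} (m : ℕ) (hmono : MonotoneOn h (Set.Ici u))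
    (hae : ∀ᵐ z ∂volume.restrict (Set.Ioi u),
      ∫ b in (0 : ℝ)..1, (m + 1) * b ^ m * h (u + (z - u) * b) =
        ((m + 1) * h z + h u) / (m + 1 + 1)) :
    ∃ a, ∀ z, u ≤ z → h z = h u + a * (z - u) := by
  have hm : (0 : ℝ) < m + 1 := by positivity
  have hm2 : (0 : ℝ) < m + 1 + 1 := by positivity
  set I : ℝ → ℝ := fun z => ∫ x in u..z, (x - u) ^ m * h x with hI
  have hint : ∀ z, u ≤ z → IntervalIntegrable (fun x => (x - u) ^ m * h x) volume u z := by
    intro z hz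
    refine IntervalIntegrable.continuousOn_mul ?_ (by fun_prop)
    refine MonotoneOn.intervalIntegrable (hmono.mono ?_)
    rw [Set.uIcc_of_le hz]
    exact Set.Icc_subset_Ici_self
  have hIcont : ContinuousOn I (Set.Ioi u) := by
    intro z hz
    have hz' : u < z := hz
    have hz1 : u ≤ z + 1 := by linarith
    have := intervalIntegral.continuousOn_primitive_interval
      (f := fun x => (x - u) ^ m * h x) (μ := volume) (a := u) (b := z + 1) (by
        rw [Set.uIcc_of_le hz1, ← intervalIntegrable_iff_integrableOn_Icc_of_le hz1]
        exact hint _ hz1)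
    rw [Set.uIcc_of_le hz1] at this
    exact (this.continuousAt (Icc_mem_nhds hz' (by linarith))).continuousWithinAt
  -- The equation solved for `h z`: the right side is continuous in `z`, so monotonicity removes the
  -- exceptional null set.
  have hEq : Set.EqOn h (fun z => ((m + 1 + 1) * I z / (z - u) ^ (m + 1) - h u / (m + 1)))
      (Set.Ioi u) := by
    refine (hmono.mono Set.Ioi_subset_Ici_self).eqOn_Ioi_of_ae_eq ?_ ?_
    · refine ContinuousOn.sub (ContinuousOn.div (by fun_prop) (by fun_prop) fun z hz => ?_)
        continuousOn_const
      exact pow_ne_zero _ (sub_pos.mpr hz).ne'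
    · filter_upwards [hae, ae_restrict_mem measurableSet_Ioi] with z hz hzu
      have hpos : 0 < z - u := sub_pos.mpr hzu
      have hk := integral_unit_eq_integral_sub_pow h m hzu
      rw [hz] at hk
      change _ = (m + 1) * I z at hk
      field_simp at hk ⊢
      linarith
  have hIeq : ∀ z, u < z → (m + 1) * (m + 1 + 1) * I z =
      (z - u) ^ (m + 1) * ((m + 1) * h z + h u) := by
    intro z hz
    have hpos : 0 < z - u := sub_pos.mpr hz
    have := hEq (Set.mem_Ioi.mpr hz)
    dsimp only at this
    rw [this]
    field_simp
    ring
  have hhcont : ContinuousOn h (Set.Ioi u) := by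
    refine ContinuousOn.congr ?_ hEq
    refine ContinuousOn.sub (ContinuousOn.div (by fun_prop) (by fun_prop) fun z hz => ?_)
      continuousOn_const
    exact pow_ne_zero _ (sub_pos.mpr hz).ne'
  have hIderiv : ∀ z, u < z → HasDerivAt I ((z - u) ^ m * h z) z := by
    intro z hz
    have hcz : ContinuousOn (fun x => (x - u) ^ m * h x) (Set.Ioi u) := by fun_prop
    exact intervalIntegral.integral_hasDerivAt_right (hint z hz.le)
      (hcz.stronglyMeasurableAtFilter isOpen_Ioi z hz) (hcz.continuousAt (Ioi_mem_nhds hz))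
  -- By `hIeq` this is `(m + 1)/(m + 2)` times the chord slope `(h z - h u)/(z - u)`. Written
  -- through `I`, it can be differentiated without assuming that `h` is differentiable.
  set φ : ℝ → ℝ := fun z => (m + 1) * I z / (z - u) ^ (m + 2) - h u / (z - u) with hφ
  have hφderiv : ∀ z, u < z → HasDerivAt φ 0 z := by
    intro z hz
    have hpos : 0 < z - u := sub_pos.mpr hz
    have hsub : HasDerivAt (fun z => z - u) 1 z := (hasDerivAt_id z).sub_const u
    have h1 := (((hIderiv z hz).const_mul ((m : ℝ) + 1)).div (hsub.pow (m + 2))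
      (pow_ne_zero _ hpos.ne')).sub ((hasDerivAt_const z (h u)).div hsub hpos.ne')
    refine h1.congr_deriv ?_
    have hI' := hIeq z hz
    have hI2 : I z = (z - u) ^ (m + 1) * ((m + 1) * h z + h u) / ((m + 1) * (m + 1 + 1)) := by
      rw [← hI']; field_simp
    simp only [Pi.pow_apply, hI2]
    push_cast
    field_simp
    simp only [pow_succ]
    ring
  obtain ⟨C, hC⟩ : ∃ C, ∀ z, u < z → φ z = C := by
    refine ⟨φ (u + 1), fun z hz => ?_⟩
    refine isOpen_Ioi.is_const_of_deriv_eq_zero (s := Set.Ioi u) isPreconnected_Ioi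
      (fun x hx => (hφderiv x hx).differentiableAt.differentiableWithinAt)
      (fun x hx => (hφderiv x hx).deriv) hz (by simp)
  refine ⟨(m + 1 + 1) / (m + 1) * C, fun z hz => ?_⟩
  rcases hz.eq_or_lt with rfl | hlt
  · simp
  have hpos : 0 < z - u := sub_pos.mpr hlt
  have hI' := hIeq z hlt
  have hI2 : I z = (z - u) ^ (m + 1) * ((m + 1) * h z + h u) / ((m + 1) * (m + 1 + 1)) := by
    rw [← hI']; field_simp
  rw [← hC z hlt]
  simp only [hφ, hI2]
  field_simp
  ring

/-- Good starting points accumulate at `0`, and the affine pieces obtained from them agree on their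
overlaps. -/
lemma eq_affine_of_ae_integral_eq {h : ℝ → ℝ} (m : ℕ) (hmono : StrictMonoOn h (Set.Ioi 0))
    (hae : ∀ᵐ u ∂volume.restrict (Set.Ioi (0 : ℝ)), ∀ᵐ z ∂volume.restrict (Set.Ioi u),
      ∫ b in (0 : ℝ)..1, (m + 1) * b ^ m * h (u + (z - u) * b) =
        ((m + 1) * h z + h u) / (m + 1 + 1)) :
    ∃ a b : ℝ, 0 < a ∧ ∀ z, 0 < z → h z = a * z + b := by
  have hsmall : ∀ ε : ℝ, 0 < ε → ∃ u ∈ Set.Ioo 0 ε, ∃ a, ∀ z, u ≤ z → h z = h u + a * (z - u) := by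
    intro ε hε
    by_contra! hcon
    rw [ae_restrict_iff' measurableSet_Ioi, ae_iff] at hae
    have hsub : Set.Ioo 0 ε ⊆ {u | ¬ (u ∈ Set.Ioi 0 → ∀ᵐ z ∂volume.restrict (Set.Ioi u),
        ∫ b in (0 : ℝ)..1, (m + 1) * b ^ m * h (u + (z - u) * b) =
          ((m + 1) * h z + h u) / (m + 1 + 1))} := by
      intro u hu hu'
      obtain ⟨a, ha⟩ := eq_affine_of_integral_eq m
        (hmono.monotoneOn.mono fun x hx => lt_of_lt_of_le hu.1 hx) (hu' hu.1)
      obtain ⟨z, hz, hne⟩ := hcon u hu a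
      exact hne (ha z hz)
    have hnull := measure_mono_null hsub hae
    rw [Real.volume_Ioo, ENNReal.ofReal_eq_zero] at hnull
    linarith
  obtain ⟨w, hw, a, ha⟩ := hsmall 1 one_pos
  -- The points `1` and `2` lie beyond every starting point used, so they determine slope and
  -- intercept for all the pieces.
  have h1 := ha 1 hw.2.le
  have h2 := ha 2 (by linarith [hw.2])
  have h12 : h 1 < h 2 := hmono (by simp) (by simp) (by norm_num)
  refine ⟨a, h 1 - a, by linarith, fun z hz => ?_⟩
  obtain ⟨u, hu, a', ha'⟩ := hsmall (min z 1) (lt_min hz one_pos)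
  have h1' := ha' 1 (hu.2.le.trans (min_le_right _ _))
  have h2' := ha' 2 ((hu.2.le.trans (min_le_right _ _)).trans (by norm_num))
  have hz' := ha' z (hu.2.le.trans (min_le_left _ _))
  have haa : a' = a := by linarith
  rw [haa] at hz' h1'
  linarith

end Affine

/-! ### Regression equation versus distribution function. -/

section Regression

variable {ν : Measure ℝ}

lemma cumHazard_pos_of_mem (hG : Continuous (cdf ν)) {y : ℝ} (hy : y ∈ openSupport ν) :
    0 < cumHazard ν y :=
  cumHazard_pos ((mem_openSupport_iff hG y).mp hy).1 ((mem_openSupport_iff hG y).mp hy).2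

lemma cumHazard_le_of_le (hG : Continuous (cdf ν)) {s t : ℝ} (ht : t ∈ openSupport ν)
    (hst : s ≤ t) : cumHazard ν s ≤ cumHazard ν t := by
  have h1 := ((mem_openSupport_iff hG t).mp ht).2
  have h2 := (cdf ν).mono hst
  exact neg_le_neg (Real.log_le_log (by linarith) (by linarith))

lemma add_mul_pos_of_mem_Ioo {u v b : ℝ} (hu : 0 < u) (huv : u ≤ v) (hb : b ∈ Set.Ioo (0 : ℝ) 1) :
    0 < u + (v - u) * b :=
  add_pos_of_pos_of_nonneg hu (mul_nonneg (by linarith) hb.1.le)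

/-- Nothing is known of `g` outside the open support, but the kernel is carried by it. -/
lemma aestronglyMeasurable_recordKernel (hG : Continuous (cdf ν)) {g : ℝ → ℝ}
    (hg : ContinuousOn g (openSupport ν)) (m : ℕ) {p : ℝ × ℝ} (h1 : p.1 ∈ openSupport ν)
    (h2 : p.2 ∈ openSupport ν) (h12 : p.1 < p.2) :
    AEStronglyMeasurable g (recordKernel ν m p) := by
  have hq := measurable_hazardQuantile hG
  have hopen := (isOpen_openSupport hG).measurableSet
  have hmem : ∀ᵐ x ∂recordKernel ν m p, x ∈ openSupport ν := by
    rw [recordKernel_apply hG]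
    refine (ae_map_iff (p := fun x => x ∈ openSupport ν) (by fun_prop) hopen).mpr ?_
    filter_upwards [ae_uniformMaxLaw_mem_Ioo m] with b hb
    exact hazardQuantile_mem_openSupport hG (add_mul_pos_of_mem_Ioo (cumHazard_pos_of_mem hG h1)
      (cumHazard_le_of_le hG h2 h12.le) hb)
  rw [← Measure.restrict_eq_self_of_ae_mem hmem]
  exact hg.aestronglyMeasurable hopen

lemma integral_recordKernel (hG : Continuous (cdf ν)) {g : ℝ → ℝ}
    (hg : ContinuousOn g (openSupport ν)) (m : ℕ) {p : ℝ × ℝ} (h1 : p.1 ∈ openSupport ν)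
    (h2 : p.2 ∈ openSupport ν) (h12 : p.1 < p.2) :
    ∫ x, g x ∂recordKernel ν m p = ∫ b, g (hazardQuantile ν
      (cumHazard ν p.1 + (cumHazard ν p.2 - cumHazard ν p.1) * b)) ∂uniformMaxLaw m := by
  have hq := measurable_hazardQuantile hG
  have hmeas := aestronglyMeasurable_recordKernel hG hg m h1 h2 h12
  rw [recordKernel_apply hG] at hmeas ⊢
  exact integral_map (by fun_prop) hmeas

lemma integrable_id_uniformMaxLaw (m : ℕ) : Integrable (fun b => b) (uniformMaxLaw m) := by
  refine Integrable.of_bound (by fun_prop) 1 ?_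
  filter_upwards [ae_uniformMaxLaw_mem_Ioo m] with b hb
  rw [Real.norm_of_nonneg hb.1.le]
  exact hb.2.le

lemma integral_id_uniformMaxLaw (m : ℕ) :
    ∫ b, b ∂uniformMaxLaw m = ((m : ℝ) + 1) / (m + 1 + 1) := by
  have h : ∀ b : ℝ, ((m : ℝ) + 1) * b ^ m * b = (m + 1) * b ^ (m + 1) := fun b => by ring
  rw [integral_uniformMaxLaw]
  simp only [h]
  rw [intervalIntegral.integral_const_mul, integral_pow]
  push_cast
  simp
  ring

/-- Here `g` is an affine function of the cumulative hazard, so only the mean `(m + 1)/(m + 2)` of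
`uniformMaxLaw m` enters. -/
lemma integral_recordKernel_of_cdf_eq (hG : Continuous (cdf ν)) {g : ℝ → ℝ} {τ c : ℝ}
    (hg : ContinuousOn g (openSupport ν)) (hc : 0 < c)
    (hcdf : ∀ y ∈ openSupport ν, cdf ν y = 1 - Real.exp (-c * (g y - τ))) (m : ℕ) {p : ℝ × ℝ}
    (h1 : p.1 ∈ openSupport ν) (h2 : p.2 ∈ openSupport ν) (h12 : p.1 < p.2) :
    Integrable g (recordKernel ν m p) ∧
      ∫ x, g x ∂recordKernel ν m p =
        (((m + 1 : ℕ) : ℝ) * g p.2 + g p.1) / (((m + 1 : ℕ) : ℝ) + 1) := by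
  have hq := measurable_hazardQuantile hG
  have hgy : ∀ y ∈ openSupport ν, g y = τ + c⁻¹ * cumHazard ν y := by
    intro y hy
    rw [cumHazard, hcdf y hy, sub_sub_cancel, Real.log_exp]
    field_simp
    ring
  set u := cumHazard ν p.1 with hu
  set v := cumHazard ν p.2 with hv
  have hae : (fun b => g (hazardQuantile ν (u + (v - u) * b))) =ᵐ[uniformMaxLaw m]
      fun b => (τ + c⁻¹ * u) + (c⁻¹ * (v - u)) * b := by
    filter_upwards [ae_uniformMaxLaw_mem_Ioo m] with b hb
    have hpos := add_mul_pos_of_mem_Ioo (cumHazard_pos_of_mem hG h1)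
      (cumHazard_le_of_le hG h2 h12.le) hb
    rw [hgy _ (hazardQuantile_mem_openSupport hG hpos), cumHazard_hazardQuantile hG hpos]
    ring
  have hid := (integrable_id_uniformMaxLaw m).const_mul (c⁻¹ * (v - u))
  constructor
  · have hmeas := aestronglyMeasurable_recordKernel hG hg m h1 h2 h12
    rw [recordKernel_apply hG] at hmeas ⊢
    rw [integrable_map_measure hmeas (by fun_prop)]
    exact ((integrable_const _).add hid).congr hae.symm
  · rw [integral_recordKernel hG hg m h1 h2 h12, integral_congr_ae hae,
      integral_add (integrable_const _) hid, integral_const_mul, integral_id_uniformMaxLaw,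
      hgy _ h1, hgy _ h2, ← hu, ← hv]
    simp only [integral_const, probReal_univ, one_smul]
    push_cast
    field_simp
    ring

/-- The limit at the left extremity fixes the intercept. As `G` is not assumed strictly increasing,
the quantile of `H(y)` could lie below `y`; instead `y` is squeezed between it and the quantiles of
all `x > H(y)`, and `x` tends to `H(y)`. -/
lemma exists_cdf_eq_of_affine (hG : Continuous (cdf ν)) {g : ℝ → ℝ} {τ a b : ℝ}
    (hgmono : StrictMonoOn g (openSupport ν)) (hgleft : Tendsto g (toLeftExtremity ν) (𝓝 τ))
    (ha : 0 < a) (haff : ∀ z, 0 < z → g (hazardQuantile ν z) = a * z + b) :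
    ∃ c : ℝ, 0 < c ∧ ∀ y ∈ openSupport ν, cdf ν y = 1 - Real.exp (-c * (g y - τ)) := by
  have hb : b = τ := by
    have h1 : Tendsto (fun z => a * z + b) (𝓝[>] 0) (𝓝 τ) := by
      refine (hgleft.comp (tendsto_hazardQuantile_toLeftExtremity hG)).congr' ?_
      filter_upwards [self_mem_nhdsWithin] with z hz
      exact haff z hz
    have h2 : Tendsto (fun z => a * z + b) (𝓝[>] 0) (𝓝 b) := by
      have : Continuous fun z : ℝ => a * z + b := by fun_prop
      simpa using (this.tendsto 0).mono_left nhdsWithin_le_nhds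
    exact tendsto_nhds_unique h2 h1
  refine ⟨a⁻¹, inv_pos.mpr ha, fun y hy => ?_⟩
  have hx := cumHazard_pos_of_mem hG hy
  have hexp := exp_neg_cumHazard ((mem_openSupport_iff hG y).mp hy).2
  have hle : hazardQuantile ν (cumHazard ν y) ≤ y := by
    rw [hazardQuantile_le_iff hG hx, hexp, sub_sub_cancel]
  have hge : a * cumHazard ν y + b ≤ g y := by
    rw [← haff _ hx]
    exact hgmono.monotoneOn (hazardQuantile_mem_openSupport hG hx) hy hle
  have hgt : ∀ x, cumHazard ν y < x → g y ≤ a * x + b := by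
    intro x hlt
    have hx0 := hx.trans hlt
    rw [← haff x hx0]
    refine (hgmono hy (hazardQuantile_mem_openSupport hG hx0) ?_).le
    rw [← not_le, hazardQuantile_le_iff hG hx0, not_le]
    have := Real.exp_lt_exp.mpr (neg_lt_neg hlt)
    linarith
  have hle' : g y ≤ a * cumHazard ν y + b := by
    have : Continuous fun z : ℝ => a * z + b := by fun_prop
    have hlim : Tendsto (fun z : ℝ => a * z + b) (𝓝[>] cumHazard ν y)
        (𝓝 (a * cumHazard ν y + b)) := (this.tendsto _).mono_left nhdsWithin_le_nhds
    refine ge_of_tendsto hlim ?_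
    filter_upwards [self_mem_nhdsWithin] with x hx'
    exact hgt x hx'
  have hgy : g y - τ = a * cumHazard ν y := by linarith
  rw [hgy, neg_mul, inv_mul_cancel_left₀ ha.ne', hexp, sub_sub_cancel]

variable [IsProbabilityMeasure ν] {Ω : Type*} [MeasurableSpace Ω] {P : Measure Ω}
  [IsProbabilityMeasure P] {Y : ℕ → Ω → ℝ}

/-- Almost sure uniqueness of regular conditional distributions allows `condDistrib` to be replaced
by the explicit kernel. -/
lemma regressionEq_recordValue_iff (hmeas : ∀ i, 1 ≤ i → Measurable (Y i))
    (hlaw : ∀ i, 1 ≤ i → P.map (Y i) = ν) (hindep : iIndepFun (fun i : ℕ => Y (i + 1)) P)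
    (hG : Continuous (cdf ν)) (g : ℝ → ℝ) (w : ℝ → ℝ → ℝ) (i m : ℕ) :
    RegressionEq P ν g (recordValue Y (i + (m + 1) + 1)) (recordValue Y (i + 1))
        (recordValue Y (i + (m + 1) + 1 + 1)) w ↔
      ∀ᵐ p ∂(Measure.infinitePi fun _ : ℕ => ν).map (fun t =>
          ((recordState i t).1, (recordState (i + (m + 1) + 1) t).1)),
        p.1 ∈ openSupport ν → p.2 ∈ openSupport ν → p.1 < p.2 →
          Integrable g (recordKernel ν m p) ∧ ∫ x, g x ∂recordKernel ν m p = w p.1 p.2 := by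
  have := isMarkovKernel_recordKernel hG m
  have hY : Measurable fun ω (j : ℕ) => Y (j + 1) ω :=
    measurable_pi_lambda _ fun j => hmeas (j + 1) (by omega)
  have hs := fun j => (measurable_recordState j).fst
  have hae := recordValue_ae_eq_recordState hmeas hlaw hindep hG
  have hpair : P.map (fun ω => (recordValue Y (i + 1) ω, recordValue Y (i + (m + 1) + 1 + 1) ω)) =
      (Measure.infinitePi fun _ : ℕ => ν).map (fun t =>
        ((recordState i t).1, (recordState (i + (m + 1) + 1) t).1)) := by
    rw [← map_shift_eq_infinitePi hmeas hlaw hindep,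
      Measure.map_map ((hs i).prodMk (hs (i + (m + 1) + 1))) hY]
    refine Measure.map_congr ?_
    filter_upwards [hae i, hae (i + (m + 1) + 1)] with ω h1 h2
    rw [h1, h2]
    rfl
  have htriple : P.map (fun ω => ((recordValue Y (i + 1) ω,
      recordValue Y (i + (m + 1) + 1 + 1) ω), recordValue Y (i + (m + 1) + 1) ω)) =
      (Measure.infinitePi fun _ : ℕ => ν).map (fun t =>
        (((recordState i t).1, (recordState (i + (m + 1) + 1) t).1),
          (recordState (i + (m + 1)) t).1)) := by
    rw [← map_shift_eq_infinitePi hmeas hlaw hindep,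
      Measure.map_map (((hs i).prodMk (hs (i + (m + 1) + 1))).prodMk (hs (i + (m + 1)))) hY]
    refine Measure.map_congr ?_
    filter_upwards [hae i, hae (i + (m + 1) + 1), hae (i + (m + 1))] with ω h1 h2 h3
    rw [h1, h2, h3]
    rfl
  have hcond := condDistrib_ae_eq_of_measure_eq_compProd (μ := P) (κ := recordKernel ν m)
    (fun ω => (recordValue Y (i + 1) ω, recordValue Y (i + (m + 1) + 1 + 1) ω))
    (Y := recordValue Y (i + (m + 1) + 1))
    (((hs (i + (m + 1))).comp hY).aemeasurable.congr (hae (i + (m + 1))).symm)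
    (by rw [htriple, hpair, map_recordState_triple_eq_compProd hG])
  rw [RegressionEq, ← hpair]
  refine eventually_congr ?_
  filter_upwards [hcond] with p hp
  rw [hp]

end Regression

theorem corollary1 {Ω : Type*} [MeasurableSpace Ω] (P : Measure Ω) [IsProbabilityMeasure P]
    -- `Y₁, Y₂, …` are independent with common law `ν` (`Y₀` is not used)
    (ν : Measure ℝ) [IsProbabilityMeasure ν] (Y : ℕ → Ω → ℝ)
    (hmeas : ∀ i, 1 ≤ i → Measurable (Y i))
    (hlaw : ∀ i, 1 ≤ i → P.map (Y i) = ν)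
    (hindep : iIndepFun (fun i : ℕ => Y (i + 1)) P)
    -- the distribution function `G` is continuous
    (hG : Continuous (cdf ν))
    -- `g` is continuous and strictly increasing in `(l_G, r_G)`, with `g(l_G+) = τ > -∞` and
    -- `g(r_G-) = ∞`
    (g : ℝ → ℝ) (τ : ℝ)
    (hgcont : ContinuousOn g (openSupport ν))
    (hgmono : StrictMonoOn g (openSupport ν))
    (hgleft : Tendsto g (toLeftExtremity ν) (𝓝 τ))
    (hgright : Tendsto g (toRightExtremity ν) atTop)
    (n k : ℕ) (hk : 1 ≤ k) (hkn : k ≤ n - 1) :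
    RegressionEq P ν g (recordValue Y n) (recordValue Y (n - k)) (recordValue Y (n + 1))
        (fun s t => ((k : ℝ) * g t + g s) / ((k : ℝ) + 1)) ↔
      ∃ c : ℝ, 0 < c ∧ ∀ y ∈ openSupport ν, cdf ν y = 1 - Real.exp (-c * (g y - τ)) := by
  -- Since `recordState j` holds record number `j + 1`, the choice `k = m + 1`, `n - k = i + 1`
  -- makes `i` the index of the conditioning record.
  obtain ⟨m, rfl⟩ : ∃ m, k = m + 1 := ⟨k - 1, by omega⟩
  obtain ⟨i, rfl⟩ : ∃ i, n = i + (m + 1) + 1 := ⟨n - (m + 1) - 1, by omega⟩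
  rw [show i + (m + 1) + 1 - (m + 1) = i + 1 by omega,
    regressionEq_recordValue_iff hmeas hlaw hindep hG]
  constructor
  · intro h
    have h' := ae_ae_of_ae_map_recordState hG i (m + 1) h
    have hmono : StrictMonoOn (fun u => g (hazardQuantile ν u)) (Set.Ioi 0) :=
      hgmono.comp (strictMonoOn_hazardQuantile hG) fun u hu => hazardQuantile_mem_openSupport hG hu
    obtain ⟨a, b, ha, haff⟩ := eq_affine_of_ae_integral_eq m hmono (by
      filter_upwards [h', ae_restrict_mem measurableSet_Ioi] with u hu hu0
      filter_upwards [hu, ae_restrict_mem measurableSet_Ioi] with z hz huz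
      have hu0' : 0 < u := hu0
      have hz0 : 0 < z := hu0'.trans huz
      have hmu := hazardQuantile_mem_openSupport hG hu0'
      have hmz := hazardQuantile_mem_openSupport hG hz0
      have hlt := (hazardQuantile_lt_iff hG hu0' hz0).mpr huz
      have hint := (hz hmu hmz hlt).2
      rw [integral_recordKernel hG hgcont m hmu hmz hlt, integral_uniformMaxLaw,
        cumHazard_hazardQuantile hG hu0', cumHazard_hazardQuantile hG hz0] at hint
      rw [hint]
      push_cast
      rfl)
    exact exists_cdf_eq_of_affine hG hgmono hgleft ha haff
  · rintro ⟨c, hc, hcdf⟩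
    exact .of_forall fun p h1 h2 h12 =>
      integral_recordKernel_of_cdf_eq hG hgcont hc hcdf m h1 h2 h12
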